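/- Let $M$ be a smooth manifold of dimension $m$ (Hausdorff, second countable, without boundary) and let $\pi:TM\to M$ be its tangent bundle. A chart $(x^i)$ of $M$ induces a chart $(x^i,v^j)$ of $TM$. The Liouville vector field on $TM$ is $\xi=\sum_i v^i\,\partial/\partial v^i$. The complete lift of a function $f$ on $M$ (a $0$-form) is the function $\widetilde f=\sum_j v^j\,\partial f/\partial x^j$ on $TM$, and the complete lift of a smooth $p$-form $\alpha=\sum_{i_1<\cdots<i_p}a_{i_1\cdots i_p}\,dx^{i_1}\wedge\cdots\wedge dx^{i_p}$ on $M$ is the smooth $p$-form on $TM$ given by $$\widetilde\alpha=\sum_{i_1<\cdots<i_p}\Bigl(\sum_j v^j\frac{\partial a_{i_1\cdots i_p}}{\partial x^j}\,dx^{i_1}\wedge\cdots\wedge dx^{i_p}+a_{i_1\cdots i_p}\sum_{k=1}^p dx^{i_1}\wedge\cdots\wedge dv^{i_k}\wedge\cdots\wedge dx^{i_p}\Bigr).$$ For $p\ge 0$ define the real vector space $$H^p(TM)^\sim=\{\widetilde\alpha:\ \alpha\in\Omega^p(M),\ d\alpha=0\}\,\big/\,\bigl(\{\widetilde\alpha:\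 \alpha\in\Omega^p(M),\ d\alpha=0\}\cap\{d\beta:\ \beta\in\Omega^{p-1}(TM)\}\bigr),$$ where $\Omega^{p}$ denotes the smooth $p$-forms and $\Omega^{-1}(TM)=0$. Theorem. For every $p\ge 0$ and every smooth $p$-form $\alpha$ on $M$, the Lie derivative of $\widetilde\alpha$ along $\xi$ is $\widetilde\alpha$ itself: $$\mathcal L_\xi\widetilde\alpha=\widetilde\alpha .$$ In particular, for every closed smooth $p$-form $\alpha$ on $M$ the form $\widetilde\alpha=d(\xi\lrcorner\widetilde\alpha)$ is exact on $TM$, with $\xi\lrcorner\widetilde\alpha$ a smooth $(p-1)$-form (for $p=0$, where $\xi\lrcorner\widetilde\alpha=0$, this says $\widetilde\alpha=0$). Thus $H^p(TM)^\sim=0$ for all $0\le p\le m$. -/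

import Mathlib

open Set Filter Topology
open scoped Manifold ContDiff

namespace TangentLift

noncomputable section

section Forms

/-! Differential forms on a smooth manifold `N` without boundary, modelled on the
finite-dimensional space `E`. -/

variable {E : Type*} [NormedAddCommGroup E] [NormedSpace ℝ E]
  {H : Type*} [TopologicalSpace H] (I : ModelWithCorners ℝ E H)
  (N : Type*) [TopologicalSpace N] [ChartedSpace H N]

/-- Fields of alternating `p`-linear forms on the tangent spaces (no regularity imposed). -/
def FormField (p : ℕ) : Type _ :=
  (x : N) → TangentSpace I x [⋀^Fin p]→L[ℝ] ℝ

instance (p : ℕ) : AddCommGroup (FormField I N p) :=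
  inferInstanceAs (AddCommGroup ((x : N) → TangentSpace I x [⋀^Fin p]→L[ℝ] ℝ))

instance (p : ℕ) : Module ℝ (FormField I N p) :=
  inferInstanceAs (Module ℝ ((x : N) → TangentSpace I x [⋀^Fin p]→L[ℝ] ℝ))

variable {I N}

lemma FormField.add_apply {p : ℕ} (α β : FormField I N p) (x : N) : (α + β) x = α x + β x := rfl

lemma FormField.smul_apply {p : ℕ} (c : ℝ) (α : FormField I N p) (x : N) :
    (c • α) x = c • α x := rfl

lemma FormField.zero_apply {p : ℕ} (x : N) : (0 : FormField I N p) x = 0 := rfl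

/-- The expression of `σ` in the chart around `x₀`: the pull-back of `σ` along the inverse of the
chart. It is meaningful on the target of the chart. -/
def inChart {p : ℕ} (σ : FormField I N p) (x₀ : N) : E → E [⋀^Fin p]→L[ℝ] ℝ := fun y =>
  (σ ((extChartAt I x₀).symm y)).compContinuousLinearMap
    (mfderiv 𝓘(ℝ, E) I (extChartAt I x₀).symm y)

variable (I N) in
/-- `Ω^p(N)`: the real vector space of smooth `p`-forms, those whose coefficients in the charts
are of class `C^∞`. -/
def smoothForms (p : ℕ) : Submodule ℝ (FormField I N p) where
  carrier := {σ | ∀ x₀ : N, ContDiffOn ℝ ∞ (inChart σ x₀) (extChartAt I x₀).target}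
  zero_mem' := fun x₀ =>
    (contDiffOn_const (c := (0 : E [⋀^Fin p]→L[ℝ] ℝ)) :
      ContDiffOn ℝ ∞ (inChart (0 : FormField I N p) x₀) _)
  add_mem' := fun hα hβ x₀ => (hα x₀).add (hβ x₀)
  smul_mem' := fun c _ hα x₀ => (hα x₀).const_smul c

lemma mem_smoothForms {p : ℕ} {σ : FormField I N p} : σ ∈ smoothForms I N p ↔
    ∀ x₀ : N, ContDiffOn ℝ ∞ (inChart σ x₀) (extChartAt I x₀).target := Iff.rfl

/-- The exterior derivative, computed at each point `x` in the chart around `x`. -/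
def extD {p : ℕ} (σ : FormField I N p) : FormField I N (p + 1) := fun x =>
  (extDeriv (inChart σ x) (extChartAt I x x)).compContinuousLinearMap
    (mfderiv I 𝓘(ℝ, E) (extChartAt I x) x)

/-- The interior product `X ⌟ σ`. -/
def interiorProduct {p : ℕ} (X : (x : N) → TangentSpace I x) (σ : FormField I N (p + 1)) :
    FormField I N p := fun x =>
  ContinuousAlternatingMap.curryLeft (E := E) (σ x) (X x)

/-- `Φ` is a smooth local flow of the vector field `X`, defined for small times on a
neighbourhood of `x`. -/
def IsLocalFlowAt (X : (x : N) → TangentSpace I x) (x : N) (Φ : ℝ → N → N) : Prop :=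
  ∃ ε > (0 : ℝ), ∃ U : Set N, IsOpen U ∧ x ∈ U ∧
    (∀ y ∈ U, Φ 0 y = y) ∧
    (∀ y ∈ U, IsMIntegralCurveOn (fun t => Φ t y) X (Ioo (-ε) ε)) ∧
    ContMDiffOn (𝓘(ℝ, ℝ).prod I) I ∞ (fun q : ℝ × N => Φ q.1 q.2) (Ioo (-ε) ε ×ˢ U)

/-- `η` is the Lie derivative of `σ` along the vector field `X`: at every point `x`,
`η = d/dt (Φ_t^* σ)` at `t = 0`, where `Φ` is the local flow of `X` around `x`
(which is unique up to shrinking its domain). -/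
def HasLieDerivative {p : ℕ} (X : (x : N) → TangentSpace I x) (σ η : FormField I N p) : Prop :=
  ∀ x : N, ∃ Φ : ℝ → N → N, IsLocalFlowAt X x Φ ∧
    ∀ w : Fin p → TangentSpace I x,
      HasDerivAt (fun t : ℝ => σ (Φ t x) (fun i => mfderiv I I (Φ t) x (w i))) (η x w) 0

section Linearity

lemma inChart_add {p : ℕ} (α β : FormField I N p) (x : N) :
    inChart (α + β) x = inChart α x + inChart β x := rfl

lemma inChart_smul {p : ℕ} (c : ℝ) (α : FormField I N p) (x : N) :
    inChart (c • α) x = c • inChart α x := rfl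

lemma extD_smul {p : ℕ} (c : ℝ) (α : FormField I N p) :
    extD (c • α) = c • extD α := by
  funext x
  simp only [extD, FormField.smul_apply, inChart_smul]
  rw [extDeriv_smul]
  rfl

lemma extD_zero {p : ℕ} : extD (0 : FormField I N p) = 0 := by
  simpa using extD_smul (0 : ℝ) (0 : FormField I N p)

variable [I.Boundaryless]

lemma differentiableAt_inChart {p : ℕ} {σ : FormField I N p} (h : σ ∈ smoothForms I N p)
    (x : N) : DifferentiableAt ℝ (inChart σ x) (extChartAt I x x) :=
  ((mem_smoothForms.1 h x).contDiffAt (extChartAt_target_mem_nhds x)).differentiableAt (by simp)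

lemma extD_add {p : ℕ} {α β : FormField I N p} (hα : α ∈ smoothForms I N p)
    (hβ : β ∈ smoothForms I N p) : extD (α + β) = extD α + extD β := by
  funext x
  simp only [extD, FormField.add_apply, inChart_add]
  rw [extDeriv_add (differentiableAt_inChart hα x) (differentiableAt_inChart hβ x)]
  rfl

variable (I N)

/-- The closed smooth `p`-forms on `N`. -/
def closedForms (p : ℕ) : Submodule ℝ (FormField I N p) where
  carrier := {α | α ∈ smoothForms I N p ∧ extD α = 0}
  zero_mem' := ⟨zero_mem _, extD_zero⟩
  add_mem' := fun hα hβ =>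
    ⟨add_mem hα.1 hβ.1, by rw [extD_add hα.1 hβ.1, hα.2, hβ.2, add_zero]⟩
  smul_mem' := fun c α hα =>
    ⟨Submodule.smul_mem _ c hα.1, by rw [extD_smul, hα.2, smul_zero]⟩

/-- The exact `p`-forms `{dβ : β ∈ Ω^{p-1}(N)}`, where `Ω^{-1}(N) = 0`. -/
def exactForms : (p : ℕ) → Submodule ℝ (FormField I N p)
  | 0 => ⊥
  | p + 1 =>
    { carrier := {σ | ∃ β ∈ smoothForms I N p, extD β = σ}
      zero_mem' := ⟨0, zero_mem _, extD_zero⟩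
      add_mem' := by
        rintro _ _ ⟨β, hβ, rfl⟩ ⟨γ, hγ, rfl⟩
        exact ⟨β + γ, add_mem hβ hγ, extD_add hβ hγ⟩
      smul_mem' := by
        rintro c _ ⟨β, hβ, rfl⟩
        exact ⟨c • β, Submodule.smul_mem _ c hβ, extD_smul c β⟩ }

end Linearity

end Forms

section Lift

variable {E : Type*} [NormedAddCommGroup E] [NormedSpace ℝ E]

/-- The coordinate expression of the complete lift. If `a = ∑_J a_J dx^J` is a `p`-form on an open
subset of `E`, with coordinates `x^i`, then at the point `(y, v)` of `E × E`, with coordinates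
`(x^i, v^j)`, the lift is
`∑_J (∑_j v^j ∂a_J/∂x^j dx^J + a_J ∑_k dx^{j_1} ∧ ⋯ ∧ dv^{j_k} ∧ ⋯ ∧ dx^{j_p})`.
The value of this form on vectors is spelled out in `coordLift_apply`. -/
def coordLift {p : ℕ} (a : E → E [⋀^Fin p]→L[ℝ] ℝ) (q : E × E) :
    (E × E) [⋀^Fin p]→L[ℝ] ℝ :=
  (fderiv ℝ a q.1 q.2).compContinuousLinearMap (ContinuousLinearMap.fst ℝ E E) +
    (a q.1).fderivCompContinuousLinearMap (ContinuousLinearMap.fst ℝ E E)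
      (ContinuousLinearMap.snd ℝ E E)

lemma coordLift_apply {p : ℕ} (a : E → E [⋀^Fin p]→L[ℝ] ℝ) (y v : E) (w : Fin p → E × E) :
    coordLift a (y, v) w = fderiv ℝ a y v (fun j => (w j).1) +
      ∑ i, a y (Function.update (fun j => (w j).1) i (w i).2) := by
  simp only [coordLift, ContinuousAlternatingMap.add_apply,
    ContinuousAlternatingMap.fderivCompContinuousLinearMap_apply]
  congr 1
  refine Finset.sum_congr rfl fun i _ => congrArg _ (funext fun j => ?_)
  by_cases h : j = i
  · subst h; simp
  · simp [Function.update_of_ne h]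

lemma coordLift_add {p : ℕ} {a b : E → E [⋀^Fin p]→L[ℝ] ℝ} {q : E × E}
    (ha : DifferentiableAt ℝ a q.1) (hb : DifferentiableAt ℝ b q.1) :
    coordLift (a + b) q = coordLift a q + coordLift b q := by
  obtain ⟨y, v⟩ := q
  ext w
  simp only [ContinuousAlternatingMap.add_apply, coordLift_apply, fderiv_add ha hb, Pi.add_apply,
    _root_.add_apply, Finset.sum_add_distrib]
  ring

lemma coordLift_smul {p : ℕ} (c : ℝ) (a : E → E [⋀^Fin p]→L[ℝ] ℝ) (q : E × E) :
    coordLift (c • a) q = c • coordLift a q := by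
  obtain ⟨y, v⟩ := q
  ext w
  have h : fderiv ℝ (c • a) y = c • fderiv ℝ a y := by
    exact congrFun (fderiv_const_smul_field (f := a) c) y
  simp [coordLift_apply, h, Finset.mul_sum, mul_add]

variable {H : Type*} [TopologicalSpace H] {I : ModelWithCorners ℝ E H}
  {M : Type*} [TopologicalSpace M] [ChartedSpace H M] [IsManifold I ∞ M]

/-- The complete lift of a `p`-form `α` on `M` to a `p`-form on `TM`. At a point `u` of `TM` it is
given by the coordinate expression `coordLift` in the chart `(x^i, v^j)` of `TM` around `u` which
is induced by the chart `x^i` of `M` around `π u`. -/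
def completeLift {p : ℕ} (α : FormField I M p) : FormField I.tangent (TangentBundle I M) p :=
  fun u => (coordLift (inChart α u.proj) (extChartAt I.tangent u u)).compContinuousLinearMap
    (mfderiv I.tangent 𝓘(ℝ, E × E) (extChartAt I.tangent u) u)

/-- The Liouville vector field `ξ = ∑ v^i ∂/∂v^i` on `TM`, written at `u` in the chart
`(x^i, v^j)` of `TM` around `u`. -/
def liouville (u : TangentBundle I M) : TangentSpace I.tangent u :=
  mfderiv I.tangent 𝓘(ℝ, E × E) (extChartAt I.tangent u) u |>.inverse
    ((0, (extChartAt I.tangent u u).2) : E × E)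

section Cohomology

lemma extChartAt_tangent_fst (u : TangentBundle I M) :
    (extChartAt I.tangent u u).1 = extChartAt I u.proj u.proj := by
  simp [ModelWithCorners.tangent]

lemma completeLift_smul {p : ℕ} (c : ℝ) (α : FormField I M p) :
    completeLift (c • α) = c • completeLift α := by
  funext u
  simp only [completeLift, FormField.smul_apply, inChart_smul, coordLift_smul]
  rfl

variable [I.Boundaryless]

lemma differentiableAt_extChartAt_fst {p : ℕ} {α : FormField I M p}
    (hα : α ∈ smoothForms I M p) (u : TangentBundle I M) :
    DifferentiableAt ℝ (inChart α u.proj) (extChartAt I.tangent u u).1 := by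
  rw [extChartAt_tangent_fst]
  exact differentiableAt_inChart hα u.proj

lemma completeLift_add {p : ℕ} {α β : FormField I M p} (hα : α ∈ smoothForms I M p)
    (hβ : β ∈ smoothForms I M p) :
    completeLift (α + β) = completeLift α + completeLift β := by
  funext u
  simp only [completeLift, FormField.add_apply, inChart_add]
  rw [coordLift_add (differentiableAt_extChartAt_fst hα u)
    (differentiableAt_extChartAt_fst hβ u)]
  rfl

variable (I M)

/-- The space `{α̃ : α ∈ Ω^p(M), dα = 0}` of complete lifts of closed `p`-forms. -/
def liftedClosedForms (p : ℕ) : Submodule ℝ (FormField I.tangent (TangentBundle I M) p) where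
  carrier := {σ | ∃ α ∈ closedForms I M p, completeLift α = σ}
  zero_mem' := ⟨0, zero_mem _, by simpa using completeLift_smul (0 : ℝ) (0 : FormField I M p)⟩
  add_mem' := by
    rintro _ _ ⟨α, hα, rfl⟩ ⟨β, hβ, rfl⟩
    exact ⟨α + β, add_mem hα hβ, completeLift_add hα.1 hβ.1⟩
  smul_mem' := by
    rintro c _ ⟨α, hα, rfl⟩
    exact ⟨c • α, Submodule.smul_mem _ c hα, completeLift_smul c α⟩

/-- The complete-lift cohomology `H^p(TM)^~`: the space of complete lifts of closed `p`-forms on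
`M`, modulo those which are exact on `TM`. -/
abbrev CompleteLiftCohomology (p : ℕ) : Type _ :=
  liftedClosedForms I M p ⧸
    (exactForms I.tangent (TangentBundle I M) p).submoduleOf (liftedClosedForms I M p)

end Cohomology

end Lift

end

end TangentLift

open TangentLift

/-!
The proof is carried out in the charts of `TM` induced by charts of `M`. The coordinate change of
two such charts is the tangent map `(y, v) ↦ (τ y, Dτ_y v)` of the coordinate change `τ` of `M`
(`extChartAt_tangent_coordChange_eventuallyEq`), and the coordinate formula `coordLift` for the
complete lift is natural under tangent maps (`coordLift_pullback`). Hence the complete lift, which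
is defined at each `u : TM` in the chart centred at `u`, is given by `coordLift` on the whole of
each induced chart (`inChart_completeLift`); smoothness follows.

The flow of the Liouville field `ξ` is `(y, v) ↦ (y, exp t • v)`. Each term of `coordLift` contains
exactly one factor `v` or `dv`, so the flow multiplies the complete lift by `exp t`
(`completeLift_liouvilleFlow`), and the derivative at `t = 0` gives `L_ξ α̃ = α̃`.

In coordinates `ξ ⌟ α̃` is the form `v ⌟ α`, without any derivative of the coefficients of `α`
(`curryLeft_coordLift`). Its exterior derivative consists of the terms of `α̃` containing some `dv`
and of an alternating sum of first derivatives of `α`, which equals `∂_v α - v ⌟ dα`; for closed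
`α` the total is `α̃` (`extDeriv_curryLeft_coordLift`). Thus `α̃ = d(ξ ⌟ α̃)` is obtained
by direct computation, without Cartan's formula for Lie derivatives on `TM`. In degree `0` the
differential of a closed form vanishes, and with it the lift.
-/

namespace TangentLift

/-! ### The complete lift in coordinates -/

section Coordinates

variable {E : Type*} [NormedAddCommGroup E] [NormedSpace ℝ E]

lemma coordLift_congr {p : ℕ} {a b : E → E [⋀^Fin p]→L[ℝ] ℝ} {q : E × E} (h : a =ᶠ[𝓝 q.1] b) :
    coordLift a q = coordLift b q := by
  rw [coordLift, coordLift, h.fderiv_eq, h.eq_of_nhds]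

lemma contDiffOn_coordLift {p : ℕ} {a : E → E [⋀^Fin p]→L[ℝ] ℝ} {s : Set E} (hs : IsOpen s)
    (ha : ContDiffOn ℝ ∞ a s) : ContDiffOn ℝ ∞ (coordLift a) (s ×ˢ (univ : Set E)) := by
  have hfst : ContDiffOn ℝ ∞ (Prod.fst : E × E → E) (s ×ˢ univ) := contDiff_fst.contDiffOn
  have hmaps : MapsTo (Prod.fst : E × E → E) (s ×ˢ univ) s := fun q hq => hq.1
  have h1 : ContDiffOn ℝ ∞ (fun q : E × E => fderiv ℝ a q.1 q.2) (s ×ˢ univ) :=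
    ((ha.fderiv_of_isOpen hs (by simp)).comp hfst hmaps).clm_apply contDiff_snd.contDiffOn
  have h2 : ContDiffOn ℝ ∞ (fun q : E × E => a q.1) (s ×ˢ univ) := ha.comp hfst hmaps
  exact ((ContinuousAlternatingMap.compContinuousLinearMapCLM
      (ContinuousLinearMap.fst ℝ E E)).contDiff.comp_contDiffOn h1).add
    ((((ContinuousAlternatingMap.fderivCompContinuousLinearMapCLM ℝ
      (ContinuousLinearMap.fst ℝ E E)).flip
        (ContinuousLinearMap.snd ℝ E E)).contDiff).comp_contDiffOn h2)

/-- The tangent map `(y, v) ↦ (τ y, Dτ_y v)` of a `C²` map `τ` has derivative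
`(w₁, w₂) ↦ (Dτ_y w₁, D²τ_y (w₁, v) + Dτ_y w₂)`. -/
lemma hasFDerivAt_tangentMap {τ : E → E} {y v : E} (hτ : ContDiffAt ℝ 2 τ y) :
    HasFDerivAt (fun q : E × E => (τ q.1, fderiv ℝ τ q.1 q.2))
      (((fderiv ℝ τ y).comp (ContinuousLinearMap.fst ℝ E E)).prod
        ((fderiv ℝ τ y).comp (ContinuousLinearMap.snd ℝ E E) +
          ((fderiv ℝ (fderiv ℝ τ) y).comp (ContinuousLinearMap.fst ℝ E E)).flip v)) (y, v) := by
  have h1 : HasFDerivAt τ (fderiv ℝ τ y) y := (hτ.differentiableAt (by simp)).hasFDerivAt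
  have h2 : HasFDerivAt (fderiv ℝ τ) (fderiv ℝ (fderiv ℝ τ) y) y :=
    ((hτ.fderiv_right (m := 1) le_rfl).differentiableAt (by simp)).hasFDerivAt
  have hf : HasFDerivAt (Prod.fst : E × E → E) (ContinuousLinearMap.fst ℝ E E) (y, v) :=
    hasFDerivAt_fst
  have hs : HasFDerivAt (Prod.snd : E × E → E) (ContinuousLinearMap.snd ℝ E E) (y, v) :=
    hasFDerivAt_snd
  exact (HasFDerivAt.comp (y, v) (g := τ) h1 hf).prodMk
    ((HasFDerivAt.comp (y, v) (g := fderiv ℝ τ) h2 hf).clm_apply hs)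

/-- The complete lift in coordinates commutes with coordinate changes: the second derivatives of
`τ` coming from the coefficients of the pulled back form and those coming from the tangent map of
`τ` agree because they are symmetric. -/
lemma coordLift_pullback {p : ℕ} {a : E → E [⋀^Fin p]→L[ℝ] ℝ} {τ : E → E} {y v : E}
    (ha : DifferentiableAt ℝ a (τ y)) (hτ : ContDiffAt ℝ 2 τ y) :
    coordLift (fun x => (a (τ x)).compContinuousLinearMap (fderiv ℝ τ x)) (y, v) =
      (coordLift a (τ y, fderiv ℝ τ y v)).compContinuousLinearMap
        (fderiv ℝ (fun q : E × E => (τ q.1, fderiv ℝ τ q.1 q.2)) (y, v)) := by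
  have hd : DifferentiableAt ℝ τ y := hτ.differentiableAt (by simp)
  have hd2 : DifferentiableAt ℝ (fderiv ℝ τ) y :=
    (hτ.fderiv_right (m := 1) le_rfl).differentiableAt (by simp)
  have hsymm : IsSymmSndFDerivAt ℝ τ y := hτ.isSymmSndFDerivAt (by simp)
  have hcd : DifferentiableAt ℝ (fun x => a (τ x)) y := ha.comp y hd
  have hcomp : fderiv ℝ (fun x => a (τ x)) y = (fderiv ℝ a (τ y)).comp (fderiv ℝ τ y) :=
    fderiv_comp y ha hd
  ext w
  rw [ContinuousAlternatingMap.compContinuousLinearMap_apply, coordLift_apply, coordLift_apply,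
    fderiv_continuousAlternatingMapCompContinuousLinearMap hcd hd2,
    (hasFDerivAt_tangentMap hτ).fderiv, hcomp]
  simp only [_root_.add_apply, ContinuousLinearMap.comp_apply,
    ContinuousAlternatingMap.add_apply, ContinuousAlternatingMap.compContinuousLinearMapCLM_apply,
    ContinuousAlternatingMap.compContinuousLinearMap_apply,
    ContinuousAlternatingMap.fderivCompContinuousLinearMap_apply, Function.comp_def,
    ContinuousLinearMap.prod_apply, ContinuousLinearMap.flip_apply, ContinuousLinearMap.coe_fst',
    ContinuousLinearMap.coe_snd', ContinuousAlternatingMap.map_update_add, Finset.sum_add_distrib]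
  -- Both sides contain a sum with entries `Dτ w₂` and a sum with second derivatives, the entries of
  -- the latter being `D²τ (v, w₁)` on the left and `D²τ (w₁, v)` on the right.
  rw [add_assoc, add_comm (∑ i, _) (∑ i, _)]
  congr 2
  · refine Finset.sum_congr rfl fun i _ => congrArg _ (funext fun j => ?_)
    by_cases h : j = i
    · subst h; simp
    · simp [Function.update_of_ne h]
  · refine Finset.sum_congr rfl fun i _ => congrArg _ (funext fun j => ?_)
    by_cases h : j = i
    · subst h; simp [hsymm.eq]
    · simp [Function.update_of_ne h]

/-- The contraction with the Liouville field kills the part of the lift which contains derivatives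
of the coefficients: `ξ ⌟ α̃` is the form `v ⌟ α`, pulled back to the tangent bundle. -/
lemma curryLeft_coordLift {p : ℕ} (a : E → E [⋀^Fin (p + 1)]→L[ℝ] ℝ) (q : E × E) :
    (coordLift a q).curryLeft (0, q.2) =
      ((a q.1).curryLeft q.2).compContinuousLinearMap (ContinuousLinearMap.fst ℝ E E) := by
  obtain ⟨y, v⟩ := q
  ext w
  -- The vector `(0, v)` has first component `0`, so only the summand in which this component is
  -- replaced by `v` survives.
  rw [ContinuousAlternatingMap.curryLeft_apply_apply, coordLift_apply, Fin.sum_univ_succ,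
    ContinuousAlternatingMap.map_coord_zero _ 0 (by simp),
    Finset.sum_eq_zero fun i _ => ContinuousAlternatingMap.map_coord_zero _ 0 ?_]
  · simp only [zero_add, add_zero, ContinuousAlternatingMap.compContinuousLinearMap_apply,
      ContinuousAlternatingMap.curryLeft_apply_apply]
    congr 1
    ext j
    cases j using Fin.cases <;> simp
  · simp [Function.update_of_ne (Fin.succ_ne_zero i).symm]

/-- The contraction of an exterior derivative with `v`, with the term in which `v` is the direction
of differentiation split off. -/
lemma alternatizeUncurryFin_vecCons {p : ℕ} (f : E →L[ℝ] E [⋀^Fin (p + 1)]→L[ℝ] ℝ) (v : E)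
    (w : Fin (p + 1) → E) :
    ContinuousAlternatingMap.alternatizeUncurryFin f (Matrix.vecCons v w) =
      f v w - ∑ i : Fin (p + 1), (-1 : ℤ) ^ (i : ℕ) • (f (w i)).curryLeft v (i.removeNth w) := by
  rw [ContinuousAlternatingMap.alternatizeUncurryFin_apply, Fin.sum_univ_succ]
  have h0 : (0 : Fin (p + 2)).removeNth (Matrix.vecCons v w) = w := rfl
  have hs : ∀ i : Fin (p + 1), i.succ.removeNth (Matrix.vecCons v w) =
      Matrix.vecCons v (i.removeNth w) := fun i =>
    Fin.cons_comp_succ_succAbove v w i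
  simp only [h0, hs, Matrix.cons_val_zero, Matrix.cons_val_succ, Fin.val_zero, Fin.val_succ,
    pow_zero, one_smul, pow_succ, mul_neg, mul_one, neg_smul, Finset.sum_neg_distrib,
    ContinuousAlternatingMap.curryLeft_apply_apply, sub_eq_add_neg]

lemma hasFDerivAt_curryLeft_comp_fst {p : ℕ} {a : E → E [⋀^Fin (p + 1)]→L[ℝ] ℝ} {y v : E}
    (ha : DifferentiableAt ℝ a y) :
    HasFDerivAt (fun q : E × E =>
      ((a q.1).curryLeft q.2).compContinuousLinearMap (ContinuousLinearMap.fst ℝ E E))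
      ((ContinuousAlternatingMap.compContinuousLinearMapCLM (ContinuousLinearMap.fst ℝ E E)).comp
        ((a y).curryLeft.comp (ContinuousLinearMap.snd ℝ E E) +
          ((ContinuousAlternatingMap.curryLeftLI.toContinuousLinearMap.comp
            (fderiv ℝ a y)).comp (ContinuousLinearMap.fst ℝ E E)).flip v)) (y, v) := by
  have hf : HasFDerivAt (Prod.fst : E × E → E) (ContinuousLinearMap.fst ℝ E E) (y, v) :=
    hasFDerivAt_fst
  have hs : HasFDerivAt (Prod.snd : E × E → E) (ContinuousLinearMap.snd ℝ E E) (y, v) :=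
    hasFDerivAt_snd
  have h0 : HasFDerivAt (fun f : E [⋀^Fin (p + 1)]→L[ℝ] ℝ => f.curryLeft)
      (ContinuousAlternatingMap.curryLeftLI (𝕜 := ℝ) (E := E) (F := ℝ)
        (n := p)).toContinuousLinearMap (a y) :=
    (ContinuousAlternatingMap.curryLeftLI (𝕜 := ℝ) (E := E) (F := ℝ)
        (n := p)).toContinuousLinearMap.hasFDerivAt
  have h1 : HasFDerivAt (fun x => (a x).curryLeft)
      (ContinuousAlternatingMap.curryLeftLI.toContinuousLinearMap.comp (fderiv ℝ a y)) y :=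
    HasFDerivAt.comp y (g := fun f : E [⋀^Fin (p + 1)]→L[ℝ] ℝ => f.curryLeft) h0 ha.hasFDerivAt
  exact HasFDerivAt.comp (y, v) (ContinuousLinearMap.hasFDerivAt
    (ContinuousAlternatingMap.compContinuousLinearMapCLM (ι := Fin p) (F := ℝ)
      (ContinuousLinearMap.fst ℝ E E)))
    ((HasFDerivAt.comp (y, v) (g := fun x => (a x).curryLeft) h1 hf).clm_apply hs)

/-- The coordinate form of `d(ξ ⌟ α̃) = α̃`, at a point over which `a` is closed. -/
lemma extDeriv_curryLeft_coordLift {p : ℕ} {a : E → E [⋀^Fin (p + 1)]→L[ℝ] ℝ} {q : E × E}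
    (ha : DifferentiableAt ℝ a q.1) (hclosed : extDeriv a q.1 = 0) :
    extDeriv (fun q : E × E => (coordLift a q).curryLeft (0, q.2)) q = coordLift a q := by
  obtain ⟨y, v⟩ := q
  have hsum := alternatizeUncurryFin_vecCons (fderiv ℝ a y) v
  rw [show ContinuousAlternatingMap.alternatizeUncurryFin (fderiv ℝ a y) = 0 from hclosed] at hsum
  simp only [curryLeft_coordLift]
  rw [extDeriv, (hasFDerivAt_curryLeft_comp_fst ha).fderiv, ContinuousLinearMap.comp_add,
    ContinuousAlternatingMap.alternatizeUncurryFin_add, coordLift]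
  -- The derivatives of the coefficients give `∂_v a`, by closedness; those of `v` give the `dv` terms.
  refine (add_comm _ _).trans (congrArg₂ _ ?_ ?_)
  · ext w
    rw [ContinuousAlternatingMap.alternatizeUncurryFin_apply]
    exact (sub_eq_zero.1 (hsum fun j => (w j).1).symm).symm
  · rw [ContinuousAlternatingMap.fderivCompContinuousLinearMap_eq_alternatizeUncurryFin]
    rfl

/-- The coordinate lift is homogeneous of degree one in the coordinates `v^j` and `dv^j` together. -/
lemma coordLift_smul_snd {p : ℕ} (a : E → E [⋀^Fin p]→L[ℝ] ℝ) (y v : E) (c : ℝ)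
    (w : Fin p → E × E) :
    coordLift a (y, c • v) (fun j => ((w j).1, c • (w j).2)) = c * coordLift a (y, v) w := by
  simp [coordLift_apply, mul_add, Finset.mul_sum]

/-- A closed `0`-form has vanishing derivative, hence vanishing complete lift. -/
lemma coordLift_eq_zero_of_extDeriv_eq_zero {a : E → E [⋀^Fin 0]→L[ℝ] ℝ} {q : E × E}
    (ha : DifferentiableAt ℝ a q.1) (hclosed : extDeriv a q.1 = 0) : coordLift a q = 0 := by
  obtain ⟨y, v⟩ := q
  ext w
  have := congrArg (fun f => f fun _ => v) hclosed
  rw [extDeriv, ContinuousAlternatingMap.alternatizeUncurryFin_apply] at this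
  rw [coordLift_apply]
  simpa [Subsingleton.elim (Fin.tail fun _ => v) fun j => (w j).1] using this

end Coordinates

/-! ### Forms in the charts of a manifold -/

section Charts

variable {E : Type*} [NormedAddCommGroup E] [NormedSpace ℝ E]
  {H : Type*} [TopologicalSpace H] {I : ModelWithCorners ℝ E H}
  {N : Type*} [TopologicalSpace N] [ChartedSpace H N]

section
variable [IsManifold I 1 N] [I.Boundaryless]

/-- The value of a form at a point, as a form on the model space; the tangent space at a point is
identified with the model space by the preferred chart at that point. -/
def FormField.toModel {p : ℕ} (σ : FormField I N p) (z : N) : E [⋀^Fin p]→L[ℝ] ℝ := σ z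

/-- A tangent vector as a vector of the model space, by the identification given by the preferred
chart at its base point. -/
def vecToModel {z : N} (w : TangentSpace I z) : E := w

/-- At the image of a point `z`, the expression of a form in the chart around `x₀` is obtained from
its value at `z` by the coordinate change to the preferred chart at `z`. -/
lemma inChart_extChartAt {p : ℕ} (σ : FormField I N p) {x₀ z : N}
    (hz : z ∈ (extChartAt I x₀).source) :
    inChart σ x₀ (extChartAt I x₀ z) =
      (σ.toModel z).compContinuousLinearMap (tangentCoordChange I x₀ z z) := by
  have hz' : z ∈ (chartAt H x₀).source := by rwa [extChartAt_source] at hz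
  have h2 : @Eq (E →L[ℝ] E)
      (mfderiv 𝓘(ℝ, E) I (extChartAt I x₀).symm (extChartAt I x₀ z))
      (tangentCoordChange I x₀ z z) := by
    have h := (TangentBundle.symmL_trivializationAt (I := I) hz').symm.trans
      (TangentBundle.symmL_trivializationAt_eq_core hz')
    rw [I.range_eq_univ, mfderivWithin_univ] at h
    exact h
  rw [← h2]
  exact congrArg (fun z' => (σ.toModel z').compContinuousLinearMap _)
    ((extChartAt I x₀).left_inv hz)

/-- The coordinate expressions of a form in two charts are related by the coordinate change. -/
lemma inChart_coordChange {p : ℕ} (σ : FormField I N p) {x₀ x₁ z : N}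
    (h₀ : z ∈ (extChartAt I x₀).source) (h₁ : z ∈ (extChartAt I x₁).source) :
    inChart σ x₀ (extChartAt I x₀ z) =
      (inChart σ x₁ (extChartAt I x₁ z)).compContinuousLinearMap
        (tangentCoordChange I x₀ x₁ z) := by
  rw [inChart_extChartAt σ h₀, inChart_extChartAt σ h₁]
  ext w
  exact congrArg (σ.toModel z) (funext fun i =>
    (tangentCoordChange_comp ⟨⟨h₀, h₁⟩, mem_extChartAt_source z⟩).symm)

lemma inChart_interiorProduct {p : ℕ} (X : (x : N) → TangentSpace I x)
    (σ : FormField I N (p + 1)) {x₀ z : N} (hz : z ∈ (extChartAt I x₀).source) :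
    inChart (interiorProduct X σ) x₀ (extChartAt I x₀ z) =
      (inChart σ x₀ (extChartAt I x₀ z)).curryLeft
        (tangentCoordChange I z x₀ z (vecToModel (X z))) := by
  rw [inChart_extChartAt _ hz, inChart_extChartAt _ hz,
    ContinuousAlternatingMap.curryLeft_compContinuousLinearMap,
    tangentCoordChange_comp ⟨⟨mem_extChartAt_source z, hz⟩, mem_extChartAt_source z⟩,
    tangentCoordChange_self (mem_extChartAt_source z)]
  rfl

omit [I.Boundaryless] in
lemma extD_apply {p : ℕ} (σ : FormField I N p) (x : N) :
    (extD σ).toModel x = extDeriv (inChart σ x) (extChartAt I x x) := by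
  rw [FormField.toModel, extD, mfderiv_extChartAt_self]
  rfl

lemma tangentCoordChange_eq_fderiv (x₀ x₁ z : N) :
    tangentCoordChange I x₀ x₁ z =
      fderiv ℝ (extChartAt I x₁ ∘ (extChartAt I x₀).symm) (extChartAt I x₀ z) := by
  rw [tangentCoordChange_def, I.range_eq_univ, fderivWithin_univ]

end

/-- Near a point of the overlap, the expression of a form in the first chart is the pull-back of
its expression in the second one. -/
lemma inChart_eventuallyEq [IsManifold I 1 N] [I.Boundaryless] {p : ℕ} (σ : FormField I N p)
    {x₀ x₁ z : N} (h₀ : z ∈ (extChartAt I x₀).source) (h₁ : z ∈ (extChartAt I x₁).source) :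
    inChart σ x₀ =ᶠ[𝓝 (extChartAt I x₀ z)] fun y =>
      (inChart σ x₁ ((extChartAt I x₁ ∘ (extChartAt I x₀).symm) y)).compContinuousLinearMap
        (fderiv ℝ (extChartAt I x₁ ∘ (extChartAt I x₀).symm) y) := by
  have ht : (extChartAt I x₀).target ∈ 𝓝 (extChartAt I x₀ z) :=
    extChartAt_target_mem_nhds' ((extChartAt I x₀).map_source h₀)
  have hc : ContinuousAt (extChartAt I x₀).symm (extChartAt I x₀ z) :=
    continuousAt_extChartAt_symm' h₀
  have hs : (extChartAt I x₁).source ∈ 𝓝 ((extChartAt I x₀).symm (extChartAt I x₀ z)) := by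
    rw [(extChartAt I x₀).left_inv h₀]
    exact extChartAt_source_mem_nhds' h₁
  filter_upwards [ht, hc hs] with y hy hy1
  have h := inChart_coordChange σ ((extChartAt I x₀).map_target hy) hy1
  rw [tangentCoordChange_eq_fderiv, (extChartAt I x₀).right_inv hy] at h
  exact h

lemma contDiffAt_coordChange {n : ℕ∞ω} [IsManifold I n N] [I.Boundaryless]
    {x₀ x₁ z : N} (h₀ : z ∈ (extChartAt I x₀).source) (h₁ : z ∈ (extChartAt I x₁).source) :
    ContDiffAt ℝ n (extChartAt I x₁ ∘ (extChartAt I x₀).symm) (extChartAt I x₀ z) := by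
  have h : extChartAt I x₀ z ∈ ((extChartAt I x₀).symm ≫ (extChartAt I x₁)).source := by
    rw [PartialEquiv.trans_source'', PartialEquiv.symm_symm, PartialEquiv.symm_target]
    exact mem_image_of_mem _ ⟨h₀, h₁⟩
  have := contDiffWithinAt_ext_coord_change (n := n) (I := I) x₁ x₀ h
  rwa [I.range_eq_univ, contDiffWithinAt_univ] at this

end Charts

/-! ### The charts of the tangent bundle -/

section TangentCharts

variable {E : Type*} [NormedAddCommGroup E] [NormedSpace ℝ E]
  {H : Type*} [TopologicalSpace H] {I : ModelWithCorners ℝ E H}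
  {M : Type*} [TopologicalSpace M] [ChartedSpace H M] [IsManifold I ∞ M]

instance [I.Boundaryless] : I.tangent.Boundaryless :=
  inferInstanceAs (I.prod 𝓘(ℝ, E)).Boundaryless

lemma extChartAt_tangent_apply (u w : TangentBundle I M) :
    extChartAt I.tangent u w =
      (extChartAt I u.proj w.proj, tangentCoordChange I w.proj u.proj w.proj w.2) := rfl

lemma extChartAt_tangent_self (u : TangentBundle I M) :
    extChartAt I.tangent u u = (extChartAt I u.proj u.proj, vecToModel u.2) :=
  congrArg (Prod.mk _) (tangentCoordChange_self (mem_extChartAt_source _))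

lemma mem_extChartAt_tangent_source {u w : TangentBundle I M} :
    w ∈ (extChartAt I.tangent u).source ↔ w.proj ∈ (extChartAt I u.proj).source := by
  rw [extChartAt_source, extChartAt_source, TangentBundle.mem_chart_source_iff]

lemma extChartAt_tangent_target [I.Boundaryless] (u : TangentBundle I M) :
    (extChartAt I.tangent u).target = (extChartAt I u.proj).target ×ˢ (univ : Set E) := by
  ext q
  rw [extChartAt_target, extChartAt_target, I.tangent.range_eq_univ, I.range_eq_univ, inter_univ,
    inter_univ, mem_preimage, TangentBundle.mem_chart_target_iff]
  exact (and_iff_left trivial).symm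

/-- The coordinate changes of `TM` are the tangent maps of the coordinate changes of `M`. -/
lemma extChartAt_tangent_coordChange_eventuallyEq [I.Boundaryless] {u₀ u₁ w : TangentBundle I M}
    (h₀ : w ∈ (extChartAt I.tangent u₀).source) (h₁ : w ∈ (extChartAt I.tangent u₁).source) :
    extChartAt I.tangent u₁ ∘ (extChartAt I.tangent u₀).symm
      =ᶠ[𝓝 (extChartAt I.tangent u₀ w)] fun q =>
      ((extChartAt I u₁.proj ∘ (extChartAt I u₀.proj).symm) q.1,
        fderiv ℝ (extChartAt I u₁.proj ∘ (extChartAt I u₀.proj).symm) q.1 q.2) := by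
  have hc : ContinuousAt (extChartAt I.tangent u₀).symm (extChartAt I.tangent u₀ w) :=
    continuousAt_extChartAt_symm' h₀
  have ht : (extChartAt I.tangent u₀).target ∈ 𝓝 (extChartAt I.tangent u₀ w) :=
    extChartAt_target_mem_nhds' ((extChartAt I.tangent u₀).map_source h₀)
  have hs : (extChartAt I.tangent u₁).source ∈
      𝓝 ((extChartAt I.tangent u₀).symm (extChartAt I.tangent u₀ w)) := by
    rw [(extChartAt I.tangent u₀).left_inv h₀]
    exact extChartAt_source_mem_nhds' h₁
  filter_upwards [ht, hc hs] with q hq hq1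
  obtain ⟨z, hz, rfl⟩ : ∃ z ∈ (extChartAt I.tangent u₀).source, extChartAt I.tangent u₀ z = q :=
    ⟨_, (extChartAt I.tangent u₀).map_target hq, (extChartAt I.tangent u₀).right_inv hq⟩
  rw [mem_preimage, (extChartAt I.tangent u₀).left_inv hz] at hq1
  have hz0 := mem_extChartAt_tangent_source.1 hz
  have hz1 := mem_extChartAt_tangent_source.1 hq1
  rw [Function.comp_apply, (extChartAt I.tangent u₀).left_inv hz, extChartAt_tangent_apply,
    extChartAt_tangent_apply]
  refine Prod.ext ?_ ?_
  · simp only [Function.comp_apply]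
    rw [(extChartAt I u₀.proj).left_inv hz0]
  · simp only
    rw [← tangentCoordChange_eq_fderiv]
    exact (tangentCoordChange_comp ⟨⟨mem_extChartAt_source z.proj, hz0⟩, hz1⟩).symm

end TangentCharts

/-! ### The complete lift and the Liouville field in induced charts -/

section LiftInCharts

variable {E : Type*} [NormedAddCommGroup E] [NormedSpace ℝ E]
  {H : Type*} [TopologicalSpace H] {I : ModelWithCorners ℝ E H}
  {M : Type*} [TopologicalSpace M] [ChartedSpace H M] [IsManifold I ∞ M]

/-- The derivative of the preferred chart at its centre is the identity, so the definition of the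
complete lift at `u` reduces to the coordinate formula. -/
lemma completeLift_toModel {p : ℕ} (α : FormField I M p) (u : TangentBundle I M) :
    (completeLift α).toModel u =
      coordLift (inChart α u.proj) (extChartAt I.tangent u u) := by
  rw [FormField.toModel, completeLift, mfderiv_extChartAt_self]
  rfl

lemma liouville_toModel (u : TangentBundle I M) :
    vecToModel (liouville u) = ((0, vecToModel u.2) : E × E) := by
  rw [vecToModel, liouville, mfderiv_extChartAt_self, extChartAt_tangent_self]
  exact congrArg (fun f : (E × E) →L[ℝ] E × E => f (0, vecToModel u.2))
    (ContinuousLinearMap.inverse_id (R := ℝ) (M := E × E))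

variable [I.Boundaryless]

/-- In every chart of `TM` induced by a chart of `M`, the complete lift is given by the coordinate
formula. -/
lemma inChart_completeLift {p : ℕ} {α : FormField I M p} (hα : α ∈ smoothForms I M p)
    {u w : TangentBundle I M} (hw : w ∈ (extChartAt I.tangent u).source) :
    inChart (completeLift α) u (extChartAt I.tangent u w) =
      coordLift (inChart α u.proj) (extChartAt I.tangent u w) := by
  have hwM := mem_extChartAt_tangent_source.1 hw
  have hself := mem_extChartAt_source (I := I) w.proj
  have hgerm := extChartAt_tangent_coordChange_eventuallyEq hw (mem_extChartAt_source w)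
  have hpt := hgerm.eq_of_nhds
  rw [Function.comp_apply, (extChartAt I.tangent u).left_inv hw] at hpt
  rw [inChart_extChartAt _ hw, completeLift_toModel, tangentCoordChange_eq_fderiv,
    hgerm.fderiv_eq, hpt]
  have hd : DifferentiableAt ℝ (inChart α w.proj)
      ((extChartAt I w.proj ∘ (extChartAt I u.proj).symm) (extChartAt I u.proj w.proj)) := by
    rw [Function.comp_apply, (extChartAt I u.proj).left_inv hwM]
    exact differentiableAt_inChart hα w.proj
  exact ((coordLift_congr (q := extChartAt I.tangent u w)
    (inChart_eventuallyEq α hwM hself)).trans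
      (coordLift_pullback hd (contDiffAt_coordChange hwM hself))).symm

lemma inChart_completeLift_eqOn {p : ℕ} {α : FormField I M p} (hα : α ∈ smoothForms I M p)
    (u : TangentBundle I M) :
    EqOn (inChart (completeLift α) u) (coordLift (inChart α u.proj))
      (extChartAt I.tangent u).target := fun q hq => by
  have := inChart_completeLift hα ((extChartAt I.tangent u).map_target hq)
  rwa [(extChartAt I.tangent u).right_inv hq] at this

theorem completeLift_mem_smoothForms {p : ℕ} {α : FormField I M p} (hα : α ∈ smoothForms I M p) :
    completeLift α ∈ smoothForms I.tangent (TangentBundle I M) p := by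
  refine mem_smoothForms.2 fun u => ContDiffOn.congr ?_ (inChart_completeLift_eqOn hα u)
  rw [extChartAt_tangent_target]
  exact contDiffOn_coordLift (isOpen_extChartAt_target _) (mem_smoothForms.1 hα u.proj)

/-- In every induced chart `(x, v)` the Liouville field has coordinates `(0, v)`. -/
lemma tangentCoordChange_liouville {u w : TangentBundle I M}
    (hw : w ∈ (extChartAt I.tangent u).source) :
    tangentCoordChange I.tangent w u w (vecToModel (liouville w)) =
      (0, (extChartAt I.tangent u w).2) := by
  have hwM := mem_extChartAt_tangent_source.1 hw
  have hself := mem_extChartAt_source (I := I) w.proj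
  rw [tangentCoordChange_eq_fderiv,
    (extChartAt_tangent_coordChange_eventuallyEq (mem_extChartAt_source w) hw).fderiv_eq,
    liouville_toModel, extChartAt_tangent_self,
    (hasFDerivAt_tangentMap (contDiffAt_coordChange hself hwM)).fderiv,
    extChartAt_tangent_apply, tangentCoordChange_eq_fderiv]
  simp
  rfl

/-- The contraction `ξ ⌟ α̃` in an induced chart. -/
lemma inChart_interiorProduct_liouville {p : ℕ} {α : FormField I M (p + 1)}
    (hα : α ∈ smoothForms I M (p + 1)) (u : TangentBundle I M) :
    EqOn (inChart (interiorProduct liouville (completeLift α)) u)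
      (fun q => (coordLift (inChart α u.proj) q).curryLeft (0, q.2))
      (extChartAt I.tangent u).target := fun q hq => by
  have hw := (extChartAt I.tangent u).map_target hq
  have h := inChart_interiorProduct liouville (completeLift α) hw
  rw [tangentCoordChange_liouville hw, (extChartAt I.tangent u).right_inv hq,
    inChart_completeLift_eqOn hα u hq] at h
  exact h

theorem interiorProduct_liouville_mem_smoothForms {p : ℕ} {α : FormField I M (p + 1)}
    (hα : α ∈ smoothForms I M (p + 1)) :
    interiorProduct liouville (completeLift α) ∈ smoothForms I.tangent (TangentBundle I M) p := by
  refine mem_smoothForms.2 fun u => ContDiffOn.congr ?_ (inChart_interiorProduct_liouville hα u)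
  have h1 : ContDiffOn ℝ ∞ (coordLift (inChart α u.proj)) (extChartAt I.tangent u).target := by
    rw [extChartAt_tangent_target]
    exact contDiffOn_coordLift (isOpen_extChartAt_target _) (mem_smoothForms.1 hα u.proj)
  have h2 : ContDiff ℝ ∞ (fun f : (E × E) [⋀^Fin (p + 1)]→L[ℝ] ℝ => f.curryLeft) :=
    ContinuousLinearMap.contDiff (𝕜 := ℝ) (E := (E × E) [⋀^Fin (p + 1)]→L[ℝ] ℝ)
      (F := E × E →L[ℝ] (E × E) [⋀^Fin p]→L[ℝ] ℝ)
      ContinuousAlternatingMap.curryLeftLI.toContinuousLinearMap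
  exact (h2.comp_contDiffOn h1).clm_apply (contDiff_const.prodMk contDiff_snd).contDiffOn

/-- Both sides are compared at `u` in the chart centred at `u`. There the definition of `extD α`
provides closedness of the coordinate expression exactly at the base point of `u`, which is all
that the coordinate computation needs. -/
theorem completeLift_eq_extD {p : ℕ} {α : FormField I M (p + 1)}
    (hα : α ∈ smoothForms I M (p + 1)) (hclosed : extD α = 0) :
    completeLift α = extD (interiorProduct liouville (completeLift α)) := by
  funext u
  change (completeLift α).toModel u =
    (extD (interiorProduct liouville (completeLift α))).toModel u
  have hd : extDeriv (inChart α u.proj) (extChartAt I.tangent u u).1 = 0 :=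
    (extD_apply α u.proj).symm.trans (congrFun hclosed u.proj)
  rw [extD_apply, completeLift_toModel,
    ((inChart_interiorProduct_liouville hα u).eventuallyEq_of_mem
      (extChartAt_target_mem_nhds u)).extDeriv_eq,
    extDeriv_curryLeft_coordLift (differentiableAt_extChartAt_fst hα u) hd]

theorem completeLift_eq_zero_of_extD_eq_zero {α : FormField I M 0}
    (hα : α ∈ smoothForms I M 0) (hclosed : extD α = 0) : completeLift α = 0 := by
  funext u
  have hd : extDeriv (inChart α u.proj) (extChartAt I.tangent u u).1 = 0 :=
    (extD_apply α u.proj).symm.trans (congrFun hclosed u.proj)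
  exact (completeLift_toModel α u).trans
    (coordLift_eq_zero_of_extDeriv_eq_zero (differentiableAt_extChartAt_fst hα u) hd)

theorem subsingleton_completeLiftCohomology (p : ℕ) :
    Subsingleton (CompleteLiftCohomology I M p) := by
  rw [Submodule.Quotient.subsingleton_iff, Submodule.submoduleOf_eq_top]
  rintro _ ⟨α, ⟨hα, hclosed⟩, rfl⟩
  cases p with
  | zero => exact completeLift_eq_zero_of_extD_eq_zero hα hclosed
  | succ p =>
    exact ⟨_, interiorProduct_liouville_mem_smoothForms hα, (completeLift_eq_extD hα hclosed).symm⟩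

end LiftInCharts

/-! ### The flow of the Liouville field -/

section Flow

variable {E : Type*} [NormedAddCommGroup E] [NormedSpace ℝ E]
  {H : Type*} [TopologicalSpace H] {I : ModelWithCorners ℝ E H}
  {M : Type*} [TopologicalSpace M] [ChartedSpace H M] [IsManifold I ∞ M]

/-- The flow of the Liouville field: multiplication by `exp t` in the fibres of `TM`. -/
noncomputable def liouvilleFlow (t : ℝ) (u : TangentBundle I M) : TangentBundle I M :=
  ⟨u.proj, Real.exp t • u.2⟩

/-- In an induced chart the flow is `(x, v) ↦ (x, exp t • v)`. -/
lemma extChartAt_liouvilleFlow (u w : TangentBundle I M) (t : ℝ) :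
    extChartAt I.tangent u (liouvilleFlow t w) =
      ((extChartAt I.tangent u w).1, Real.exp t • (extChartAt I.tangent u w).2) :=
  congrArg (Prod.mk _)
    ((tangentCoordChange I w.proj u.proj w.proj).map_smul (Real.exp t) (vecToModel w.2))

/-- The preferred chart of `TM` at a point depends only on its base point, which the flow fixes. -/
lemma extChartAt_liouvilleFlow_self (u w : TangentBundle I M) (t : ℝ) :
    extChartAt I.tangent (liouvilleFlow t u) w = extChartAt I.tangent u w := rfl

lemma contMDiff_liouvilleFlow :
    ContMDiff (𝓘(ℝ, ℝ).prod I.tangent) I.tangent ∞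
      (fun q : ℝ × TangentBundle I M => liouvilleFlow q.1 q.2) := by
  intro q
  have hsnd : ContMDiffAt (𝓘(ℝ, ℝ).prod I.tangent) I.tangent ∞
      (Prod.snd : ℝ × TangentBundle I M → TangentBundle I M) q := contMDiffAt_snd
  have hfst : ContMDiffAt (𝓘(ℝ, ℝ).prod I.tangent) 𝓘(ℝ, ℝ) ∞
      (fun q : ℝ × TangentBundle I M => Real.exp q.1) q :=
    Real.contDiff_exp.contMDiff.contMDiffAt.comp q contMDiffAt_fst
  have h := Bundle.contMDiffAt_totalSpace.1 hsnd
  refine Bundle.contMDiffAt_totalSpace.2 ⟨h.1, (hfst.smul h.2).congr_of_eventuallyEq ?_⟩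
  filter_upwards with r
  exact congrArg Prod.snd (extChartAt_liouvilleFlow q.2 r.2 r.1)

lemma continuous_liouvilleFlow_time (u : TangentBundle I M) :
    Continuous fun t : ℝ => liouvilleFlow t u :=
  contMDiff_liouvilleFlow.continuous.comp (continuous_id.prodMk continuous_const)

lemma continuous_liouvilleFlow (t : ℝ) :
    Continuous (liouvilleFlow t : TangentBundle I M → TangentBundle I M) :=
  contMDiff_liouvilleFlow.continuous.comp (continuous_const.prodMk continuous_id)

lemma hasMFDerivAt_liouvilleFlow_time (u : TangentBundle I M) (t : ℝ) :
    HasMFDerivAt 𝓘(ℝ, ℝ) I.tangent (fun s : ℝ => liouvilleFlow s u) t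
      ((1 : ℝ →L[ℝ] ℝ).smulRight (liouville (liouvilleFlow t u))) := by
  refine ⟨(continuous_liouvilleFlow_time u).continuousAt, ?_⟩
  have h : HasDerivAt (fun s : ℝ => ((extChartAt I u.proj u.proj, Real.exp s • vecToModel u.2) :
      E × E)) (0, Real.exp t • vecToModel u.2) t :=
    (hasDerivAt_const t _).prodMk ((Real.hasDerivAt_exp t).smul_const _)
  have hw : writtenInExtChartAt 𝓘(ℝ, ℝ) I.tangent t (fun s : ℝ => liouvilleFlow s u) =
      fun s : ℝ => ((extChartAt I u.proj u.proj, Real.exp s • vecToModel u.2) : E × E) := by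
    funext s
    change extChartAt I.tangent u (liouvilleFlow s u) = _
    rw [extChartAt_liouvilleFlow, extChartAt_tangent_self]
  have hl : vecToModel (liouville (liouvilleFlow t u)) =
      ((0, Real.exp t • vecToModel u.2) : E × E) := liouville_toModel _
  rw [hw]
  refine HasFDerivAt.hasFDerivWithinAt ?_
  have h' := h.hasFDerivAt
  rw [← hl] at h'
  exact h'

variable [I.Boundaryless]

lemma mfderiv_liouvilleFlow (t : ℝ) (u : TangentBundle I M) (w : TangentSpace I.tangent u) :
    vecToModel (mfderiv I.tangent I.tangent (liouvilleFlow t) u w) =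
      (((vecToModel w).1, Real.exp t • (vecToModel w).2) : E × E) := by
  have h : HasMFDerivAt I.tangent I.tangent (liouvilleFlow t) u
      ((ContinuousLinearMap.id ℝ E).prodMap (Real.exp t • ContinuousLinearMap.id ℝ E) :
        E × E →L[ℝ] E × E) := by
    refine ⟨(continuous_liouvilleFlow t).continuousAt, HasFDerivAt.hasFDerivWithinAt ?_⟩
    refine HasFDerivAt.congr_of_eventuallyEq (ContinuousLinearMap.hasFDerivAt _) ?_
    filter_upwards [extChartAt_target_mem_nhds (I := I.tangent) u] with q hq
    change extChartAt I.tangent u (liouvilleFlow t ((extChartAt I.tangent u).symm q)) = _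
    rw [extChartAt_liouvilleFlow, (extChartAt I.tangent u).right_inv hq]
    rfl
  rw [h.mfderiv]
  rfl

omit [I.Boundaryless] in
lemma isLocalFlowAt_liouvilleFlow (u : TangentBundle I M) :
    IsLocalFlowAt (I := I.tangent) liouville u liouvilleFlow := by
  refine ⟨1, one_pos, univ, isOpen_univ, mem_univ u, fun y _ => ?_, fun y _ t _ =>
    (hasMFDerivAt_liouvilleFlow_time y t).hasMFDerivWithinAt,
    contMDiff_liouvilleFlow.contMDiffOn⟩
  simp [liouvilleFlow]

/-- The pull-back of `α̃` along the flow at time `t` is `exp t • α̃`. -/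
lemma completeLift_liouvilleFlow {p : ℕ} (α : FormField I M p) (t : ℝ) (u : TangentBundle I M)
    (w : Fin p → TangentSpace I.tangent u) :
    completeLift α (liouvilleFlow t u)
      (fun i => mfderiv I.tangent I.tangent (liouvilleFlow t) u (w i)) =
      Real.exp t * completeLift α u w := by
  have h1 : (completeLift α).toModel (liouvilleFlow t u) = _ := completeLift_toModel _ _
  rw [extChartAt_liouvilleFlow_self, extChartAt_liouvilleFlow] at h1
  have h2 := coordLift_smul_snd (inChart α u.proj) (extChartAt I.tangent u u).1
    (extChartAt I.tangent u u).2 (Real.exp t) (fun i => vecToModel (w i))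
  refine Eq.trans ?_ (h2.trans ?_)
  · exact congrArg₂ (fun (f : (E × E) [⋀^Fin p]→L[ℝ] ℝ) v => f v) h1
      (funext fun i => mfderiv_liouvilleFlow t u (w i))
  · exact congrArg (fun f : (E × E) [⋀^Fin p]→L[ℝ] ℝ => Real.exp t * f w)
      (completeLift_toModel α u).symm

theorem hasLieDerivative_liouville_completeLift {p : ℕ} (α : FormField I M p) :
    HasLieDerivative liouville (completeLift α) (completeLift α) := by
  refine fun u => ⟨liouvilleFlow, isLocalFlowAt_liouvilleFlow u, fun w => ?_⟩
  simp only [completeLift_liouvilleFlow]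
  simpa using (Real.hasDerivAt_exp 0).mul_const (completeLift α u w)

end Flow

end TangentLift

theorem mainTheorem1 (m : ℕ) (M : Type*) [TopologicalSpace M] [T2Space M]
    [SecondCountableTopology M] [ChartedSpace (EuclideanSpace ℝ (Fin m)) M]
    [IsManifold (𝓡 m) ∞ M] :
    -- `L_ξ α̃ = α̃` for every `p`-form `α`, where `α̃` is a smooth form on `TM`
    (∀ (p : ℕ), ∀ α ∈ smoothForms (𝓡 m) M p,
      completeLift α ∈ smoothForms (𝓡 m).tangent (TangentBundle (𝓡 m) M) p ∧
      HasLieDerivative liouville (completeLift α) (completeLift α)) ∧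
    -- every closed form `α` of positive degree has `α̃ = d(ξ ⌟ α̃)`, with `ξ ⌟ α̃` smooth
    (∀ (p : ℕ), ∀ α ∈ smoothForms (𝓡 m) M (p + 1), extD α = 0 →
      interiorProduct liouville (completeLift α) ∈
        smoothForms (𝓡 m).tangent (TangentBundle (𝓡 m) M) p ∧
      completeLift α = extD (interiorProduct liouville (completeLift α))) ∧
    -- in degree `0`, where `ξ ⌟ α̃ = 0`, this reads `α̃ = 0`
    (∀ α ∈ smoothForms (𝓡 m) M 0, extD α = 0 → completeLift α = 0) ∧
    -- the complete-lift cohomology vanishes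
    (∀ p ≤ m, Subsingleton (CompleteLiftCohomology (𝓡 m) M p)) := by
  exact ⟨fun p α hα =>
      ⟨completeLift_mem_smoothForms hα, hasLieDerivative_liouville_completeLift α⟩,
    fun p α hα hclosed =>
      ⟨interiorProduct_liouville_mem_smoothForms hα, completeLift_eq_extD hα hclosed⟩,
    fun α hα hclosed => completeLift_eq_zero_of_extD_eq_zero hα hclosed,
    fun p _ => subsingleton_completeLiftCohomology p⟩
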